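/- Let $\mathcal C$ be a space of classes with prior density $p(c)$ (with respect to a $\sigma$-finite reference measure $\mathrm dc$, e.g. counting measure), let $p_0(x\mid c)$ be a probability density on $\mathbb R^d$ for every class $c$ (jointly measurable in $(x,c)$), and let $p_0(x)=\int p(c)\,p_0(x\mid c)\,\mathrm dc$ and $p(c\mid x)=p(c)\,p_0(x\mid c)/p_0(x)$. Fix $\sigma_{\max}>0$, put $\sigma_s=\sigma_{\max}s$, and fix a noise scale $\kappa>0$. For $s\in[0,1]$ let $p_s(\cdot\mid c)$ and $p_s(\cdot)$ be the densities of $x_0+\kappa s z$, where $z\sim\mathcal N(0,I)$ is independent of $x_0$ and $x_0\sim p_0(\cdot\mid c)$, respectively $x_0\sim p_0$. (For $\kappa=\sigma_{\max}$ this is the path with kernel $\mathcal N(x_0,\sigma_s^2I)$; for $\kappa=\sqrt{\sigma_{\max}}$ it gives the marginals of the SDE $\mathrm dx_s=\sqrt{2\sigma_s}\,\mathrm dw_s$.) The class-$c$ and the unconditional probability flow ODEs are $$\frac{\mathrm dx_s}{\mathrm ds}=-\sigma_s\nabla_x\log p_s(x_s\mid c),\qquad \frac{\mathrm dx_s}{\mathrm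 ds}=-\sigma_s\nabla_x\log p_s(x_s),$$ and $\mathrm{Solver}^{c}_{a\to b}(x)$, $\mathrm{Solver}^{\emptyset}_{a\to b}(x)$ denote the value at time $b$ of their solution that equals $x$ at time $a$. Fix a class $c$ with $p(c)>0$. Assume that $p_0(\cdot\mid c)$ and $p_0$ are everywhere positive and differentiable, that the scores $\nabla_x\log p_s(x\mid c)$ and $\nabla_x\log p_s(x)$ are continuous in $(s,x)\in[0,1]\times\mathbb R^d$, and that the vector fields of the two ODEs are Lipschitz in $x$, uniformly in $s\in[0,1]$. Let $x_0^c\in\mathbb R^d$, and for $t\in[0,1]$ let $$f(t)=\mathrm{Solver}^{\emptyset}_{t\to0}\bigl(\mathrm{Solver}^{c}_{0\to t}(x_0^c)\bigr),\qquad g(t)=f(0)+\frac{f(0)-f(t)}{t}\quad(t>0).$$ Then $f(0)=x_0^c$, the function $f$ is differentiable on $[0,\varepsilon]$ for some $\varepsilon>0$ and twice differentiable at $0$ (one-sidedly at $0$), with $$f'(0)=0,\qquad f''(0)=-\sigma_{\max}\nabla_x\log p(c\mid x)\big|_{x=x_0^c},$$ and $$g(t)=x_0^c+\frac{\sigma_{\max}t}{2}\,\nabla_x\log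 p(c\mid x)\big|_{x=x_0^c}+o(t)\qquad(t\to0^+).$$ -/

import Mathlib

open Set Filter Topology MeasureTheory Asymptotics
open scoped NNReal

noncomputable section

namespace HybridFlow

/-- The state space `ℝ^d` with its Euclidean norm. -/
abbrev Space (d : ℕ) : Type := EuclideanSpace ℝ (Fin d)

/-- A class-conditioned data distribution: a prior density `p(c)` on the space `C` of classes
(with respect to a reference measure `ν`, e.g. counting measure) and, for every class `c`, a data
density `p₀(x | c)` on `ℝ^d`. -/
structure ClassData (d : ℕ) (C : Type*) [MeasurableSpace C] (ν : Measure C) where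
  /-- the class prior `p(c)` -/
  prior : C → ℝ
  /-- the class-conditioned data density `p₀(x | c)` -/
  cond : C → Space d → ℝ
  prior_measurable : Measurable prior
  prior_nonneg : ∀ c, 0 ≤ prior c
  prior_integral : ∫ c, prior c ∂ν = 1
  cond_measurable : Measurable (Function.uncurry cond)
  cond_nonneg : ∀ c x, 0 ≤ cond c x
  cond_integral : ∀ c, ∫ x, cond c x = 1

/-- The unconditional data density `p₀(x) = ∫ p(c) p₀(x | c) dc`. -/
def ClassData.marginal {d : ℕ} {C : Type*} [MeasurableSpace C] {ν : Measure C}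
    (D : ClassData d C ν) (x : Space d) : ℝ :=
  ∫ c, D.prior c * D.cond c x ∂ν

/-- The class posterior `p(c | x) = p(c) p₀(x | c) / p₀(x)`. -/
def ClassData.posterior {d : ℕ} {C : Type*} [MeasurableSpace C] {ν : Measure C}
    (D : ClassData d C ν) (c : C) (x : Space d) : ℝ :=
  D.prior c * D.cond c x / D.marginal x

/-- The density at `z` of the isotropic Gaussian `𝒩(0, τ² I)` on `ℝ^d`. -/
def gaussianDensity {d : ℕ} (τ : ℝ) (z : Space d) : ℝ :=
  (Real.sqrt (2 * Real.pi * τ ^ 2))⁻¹ ^ d * Real.exp (-‖z‖ ^ 2 / (2 * τ ^ 2))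

/-- The density of `x₀ + κ s z`, where `x₀` has density `p` and `z ∼ 𝒩(0, I)` is independent of
`x₀`: the convolution of `p` with `𝒩(0, (κ s)² I)`, and `p` itself at time `s = 0`. -/
def noised {d : ℕ} (κ : ℝ) (p : Space d → ℝ) (s : ℝ) (x : Space d) : ℝ :=
  if s = 0 then p x else ∫ y, gaussianDensity (κ * s) (x - y) * p y

/-- The score `∇ₓ log p(x)`. -/
def score {d : ℕ} (p : Space d → ℝ) (x : Space d) : Space d :=
  gradient (fun y => Real.log (p y)) x

/-- The vector field `(s, x) ↦ -σ_s ∇ₓ log p_s(x)`, `σ_s = σmax s`, of the probability flow ODE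
of the noised densities `p_s` of `p`. -/
def pfField {d : ℕ} (σmax κ : ℝ) (p : Space d → ℝ) (s : ℝ) (x : Space d) : Space d :=
  -((σmax * s) • score (noised κ p s) x)

/-- Standing regularity of a probability flow ODE on the time interval `[0, 1]`: the initial
density is positive and differentiable (so that its score makes sense), the score is continuous in
time and space up to time `0`, and the vector field is Lipschitz in space, uniformly in time. -/
structure RegularFlow {d : ℕ} (σmax κ : ℝ) (p : Space d → ℝ) : Prop where
  pos : ∀ x, 0 < p x
  differentiable : Differentiable ℝ p
  continuous_score : ContinuousOn (fun z : ℝ × Space d => score (noised κ p z.1) z.2)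
    (Icc (0 : ℝ) 1 ×ˢ univ)
  lipschitz : ∃ K : ℝ≥0, ∀ s ∈ Icc (0 : ℝ) 1, LipschitzWith K (pfField σmax κ p s)

/-- `γ` solves `dγ/ds = v_s(γ(s))` between the times `a` and `b` (in either order), with
`γ(a) = x`. -/
def IsSolution {d : ℕ} (v : ℝ → Space d → Space d) (a b : ℝ) (x : Space d)
    (γ : ℝ → Space d) : Prop :=
  γ a = x ∧ ∀ s ∈ uIcc a b, HasDerivWithinAt γ (v s (γ s)) (uIcc a b) s

open Classical in
/-- `Solver_{a → b}(x)`: the value at time `b` of the solution of `dγ/ds = v_s(γ(s))` with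
`γ(a) = x`. For continuous vector fields that are Lipschitz in space the solution exists and is
unique between `a` and `b`; the value `x` in the absence of a solution is a convention. -/
def solver {d : ℕ} (v : ℝ → Space d → Space d) (a b : ℝ) (x : Space d) : Space d :=
  if h : ∃ γ, IsSolution v a b x γ then h.choose b else x

/-- The hybrid flow `f(t)`: the class-`c` flow from `0` to `t` started at `x₀`, followed by the
unconditional flow from `t` back to `0`. -/
def hybridFlow {d : ℕ} {C : Type*} [MeasurableSpace C] {ν : Measure C} (D : ClassData d C ν)
    (σmax κ : ℝ) (c : C) (x₀ : Space d) (t : ℝ) : Space d :=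
  solver (pfField σmax κ D.marginal) t 0 (solver (pfField σmax κ (D.cond c)) 0 t x₀)

/-- The mixed signal `g(t) = f(0) + (f(0) - f(t)) / t`. -/
def mixedSignal {d : ℕ} (f : ℝ → Space d) (t : ℝ) : Space d :=
  f 0 + t⁻¹ • (f 0 - f t)

end HybridFlow

end

/-! Let v₁, v₂ be the class-c and unconditional fields, γ the v₁-trajectory from x₀, and M_t the
derivative at γ(t) of the v₂-flow from time t back to 0. Only the velocity of γ relative to v₂
survives the transport back, so f'(t) = M_t (v₁ - v₂)(t, γ(t))
(`exists_hasDerivWithinAt_solver_comp`). Here v₁ - v₂ = -σmax t S(t), where S is the difference of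
the two scores along γ; it is continuous up to t = 0, and by Bayes S(0) = G := ∇ log p(c | x₀).
Since ‖M_t - id‖ ≤ 2Kt, f'(t) = -σmax t G + o(t). This yields f'(0), f''(0) and, by the mean value
inequality, the expansion of g.

The delicate point is that M_t exists, since the flow of a merely Lipschitz field need not be
differentiable in its starting point. At times s > 0 Gaussian smoothing makes the field C¹
(`contDiffOn_pfField`). Near s = 0 no such regularity is available, but the flow across [0, δ]
changes differences of trajectories only by a relative error O(δ), and that suffices
(`differentiableAt_flow_to_zero`). -/

namespace HybridFlow

/-! ### Smoothness of Gaussian-weighted exponential integrals. -/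

section GaussianTransform

universe u

variable {E : Type u} [NormedAddCommGroup E] [InnerProductSpace ℝ E]

/-- The linear form `(a, b) ↦ ⟪a, y⟫ - b ‖y‖²`. -/
noncomputable def gaussianForm (y : E) : E × ℝ →L[ℝ] ℝ :=
  (innerSL ℝ y).coprod (-(‖y‖ ^ 2) • ContinuousLinearMap.id ℝ ℝ)

theorem gaussianForm_apply (y : E) (z : E × ℝ) :
    gaussianForm y z = inner ℝ y z.1 - z.2 * ‖y‖ ^ 2 := by
  simp [gaussianForm]; ring

theorem norm_gaussianForm_le (y : E) : ‖gaussianForm y‖ ≤ 1 + 2 * ‖y‖ ^ 2 := by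
  refine ContinuousLinearMap.opNorm_le_bound _ (by positivity) fun z => ?_
  rw [gaussianForm_apply, Real.norm_eq_abs]
  have h1 := abs_real_inner_le_norm y z.1
  have h2 := norm_fst_le z
  have h3 := norm_snd_le z
  rw [Real.norm_eq_abs] at h3
  have h4 : |z.2 * ‖y‖ ^ 2| = |z.2| * ‖y‖ ^ 2 := by rw [abs_mul, abs_of_nonneg (sq_nonneg ‖y‖)]
  have h5 : ‖y‖ * ‖z.1‖ ≤ (1 + ‖y‖ ^ 2) * ‖z‖ :=
    mul_le_mul (by nlinarith [sq_nonneg (‖y‖ - 1)]) h2 (norm_nonneg _) (by positivity)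
  have h6 : |z.2| * ‖y‖ ^ 2 ≤ ‖z‖ * ‖y‖ ^ 2 := by gcongr
  calc |inner ℝ y z.1 - z.2 * ‖y‖ ^ 2| ≤ |inner ℝ y z.1| + |z.2 * ‖y‖ ^ 2| := abs_sub _ _
    _ ≤ (1 + 2 * ‖y‖ ^ 2) * ‖z‖ := by rw [h4]; linarith

theorem continuous_gaussianForm : Continuous (gaussianForm : E → E × ℝ →L[ℝ] ℝ) := by
  have h : (gaussianForm : E → E × ℝ →L[ℝ] ℝ) = fun y =>
      (innerSL ℝ y).comp (ContinuousLinearMap.fst ℝ E ℝ) +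
        (-(‖y‖ ^ 2)) • ContinuousLinearMap.snd ℝ E ℝ := by
    ext y z <;> simp [gaussianForm]
  rw [h]
  fun_prop

/-- The exponent of the transform is dominated by a centred Gaussian. -/
theorem gaussianForm_le {z : E × ℝ} {b r : ℝ} (hb : 0 < b) (hz : b ≤ z.2) (hr : ‖z.1‖ ≤ r)
    (y : E) : gaussianForm y z ≤ r ^ 2 / (2 * b) + -(b / 2) * ‖y‖ ^ 2 := by
  rw [gaussianForm_apply]
  have h1 : inner ℝ y z.1 ≤ ‖y‖ * r :=
    (real_inner_le_norm y z.1).trans (by gcongr)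
  have h2 : b * ‖y‖ ^ 2 ≤ z.2 * ‖y‖ ^ 2 := by gcongr
  have h3 : r ^ 2 / (2 * b) + -(b / 2) * ‖y‖ ^ 2 - (‖y‖ * r - b * ‖y‖ ^ 2)
      = (r - b * ‖y‖) ^ 2 / (2 * b) := by
    field_simp; ring
  have h4 : 0 ≤ (r - b * ‖y‖) ^ 2 / (2 * b) := by positivity
  linarith

variable [MeasurableSpace E]

/-- A function whose products with all centred Gaussians are integrable. -/
def GaussianIntegrable {F : Type*} [NormedAddCommGroup F] (μ : Measure E) (g : E → F) : Prop :=
  AEStronglyMeasurable g μ ∧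
    ∀ b : ℝ, 0 < b → Integrable (fun y => Real.exp (-b * ‖y‖ ^ 2) * ‖g y‖) μ

/-- The transform `(a, b) ↦ ∫ exp(⟪a, y⟫ - b ‖y‖²) g(y) dμ(y)`. -/
noncomputable def gaussianTransform {F : Type*} [NormedAddCommGroup F] [NormedSpace ℝ F]
    (μ : Measure E) (g : E → F) (z : E × ℝ) : F :=
  ∫ y, Real.exp (gaussianForm y z) • g y ∂μ

variable [BorelSpace E]

theorem gaussianIntegrable_of_integrable {F : Type*} [NormedAddCommGroup F]
    {μ : Measure E} {g : E → F} (hg : Integrable g μ) : GaussianIntegrable μ g := by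
  refine ⟨hg.1, fun b hb => hg.norm.mono'
    ((Continuous.aestronglyMeasurable (by fun_prop)).mul hg.1.norm)
    (Eventually.of_forall fun y => ?_)⟩
  rw [Real.norm_of_nonneg (by positivity)]
  refine mul_le_of_le_one_left (norm_nonneg _) (Real.exp_le_one_iff.2 ?_)
  have : 0 ≤ b * ‖y‖ ^ 2 := by positivity
  linarith

variable {F : Type*} [NormedAddCommGroup F]
  [NormedSpace ℝ F] {μ : Measure E} {g : E → F}

theorem GaussianIntegrable.aestronglyMeasurable_exp_smul (hg : GaussianIntegrable μ g)
    (z : E × ℝ) : AEStronglyMeasurable (fun y => Real.exp (gaussianForm y z) • g y) μ := by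
  have h : Continuous fun y : E => Real.exp (gaussianForm y z) :=
    Real.continuous_exp.comp (continuous_gaussianForm.clm_apply continuous_const)
  exact h.aestronglyMeasurable.smul hg.1

theorem GaussianIntegrable.integrable_exp_smul (hg : GaussianIntegrable μ g)
    {z : E × ℝ} (hz : 0 < z.2) : Integrable (fun y => Real.exp (gaussianForm y z) • g y) μ := by
  refine ((hg.2 (z.2 / 2) (by positivity)).const_mul (Real.exp (‖z.1‖ ^ 2 / (2 * z.2)))).mono'
    (hg.aestronglyMeasurable_exp_smul z) (Eventually.of_forall fun y => ?_)
  rw [norm_smul, Real.norm_of_nonneg (Real.exp_nonneg _), ← mul_assoc, ← Real.exp_add]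
  gcongr
  exact gaussianForm_le hz le_rfl le_rfl y

variable [FiniteDimensional ℝ E]

/-- Differentiating the transform costs a factor of quadratic growth in y, absorbed by giving up
half of the Gaussian exponent. This closure property drives the induction in `contDiffOn`. -/
theorem GaussianIntegrable.smulRight (hg : GaussianIntegrable μ g) :
    GaussianIntegrable μ (fun y => (gaussianForm y).smulRight (g y)) := by
  have hm : AEStronglyMeasurable (fun y => (gaussianForm y).smulRight (g y)) μ :=
    isBoundedBilinearMap_smulRight.continuous.comp_aestronglyMeasurable
      (continuous_gaussianForm.aestronglyMeasurable.prodMk hg.1)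
  refine ⟨hm, fun b hb => ?_⟩
  refine ((hg.2 (b / 2) (by positivity)).const_mul (1 + 4 / b)).mono'
    ((Continuous.aestronglyMeasurable (by fun_prop)).mul hm.norm) (Eventually.of_forall fun y => ?_)
  rw [Real.norm_of_nonneg (by positivity), ContinuousLinearMap.norm_smulRight_apply]
  have h1 : 1 + 2 * ‖y‖ ^ 2 ≤ (1 + 4 / b) * Real.exp (b / 2 * ‖y‖ ^ 2) := by
    have h := Real.add_one_le_exp (b / 2 * ‖y‖ ^ 2)
    have h2 : (1 + 4 / b) * (b / 2 * ‖y‖ ^ 2 + 1) = 1 + 2 * ‖y‖ ^ 2 + (b / 2 * ‖y‖ ^ 2 + 4 / b) := by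
      field_simp; ring
    have h3 : 0 ≤ b / 2 * ‖y‖ ^ 2 + 4 / b := by positivity
    calc _ ≤ (1 + 4 / b) * (b / 2 * ‖y‖ ^ 2 + 1) := by linarith
      _ ≤ _ := by gcongr
  calc Real.exp (-b * ‖y‖ ^ 2) * (‖gaussianForm y‖ * ‖g y‖)
      ≤ Real.exp (-b * ‖y‖ ^ 2) * (((1 + 4 / b) * Real.exp (b / 2 * ‖y‖ ^ 2)) * ‖g y‖) := by
        gcongr
        exact (norm_gaussianForm_le y).trans h1
    _ = (1 + 4 / b) * (Real.exp (-(b / 2) * ‖y‖ ^ 2) * ‖g y‖) := by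
        have : Real.exp (-(b / 2) * ‖y‖ ^ 2)
            = Real.exp (-b * ‖y‖ ^ 2) * Real.exp (b / 2 * ‖y‖ ^ 2) := by
          rw [← Real.exp_add]; ring_nf
        rw [this]; ring

theorem GaussianIntegrable.hasFDerivAt (hg : GaussianIntegrable μ g)
    {z : E × ℝ} (hz : 0 < z.2) :
    HasFDerivAt (gaussianTransform μ g)
      (gaussianTransform μ (fun y => (gaussianForm y).smulRight (g y)) z) z := by
  -- On this neighbourhood the quadratic coefficient stays above half its value at z, so one
  -- Gaussian dominates all the integrands.
  have hU : {w : E × ℝ | z.2 / 2 < w.2 ∧ ‖w.1‖ < ‖z.1‖ + 1} ∈ 𝓝 z := by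
    refine IsOpen.mem_nhds ?_ ⟨by linarith, by linarith⟩
    exact (isOpen_lt continuous_const continuous_snd).inter
      (isOpen_lt continuous_fst.norm continuous_const)
  refine hasFDerivAt_integral_of_dominated_of_fderiv_le
    (F' := fun w y => Real.exp (gaussianForm y w) • (gaussianForm y).smulRight (g y))
    (bound := fun y => Real.exp ((‖z.1‖ + 1) ^ 2 / (2 * (z.2 / 2))) *
      (Real.exp (-(z.2 / 2 / 2) * ‖y‖ ^ 2) * ‖(gaussianForm y).smulRight (g y)‖)) hU
    (Eventually.of_forall fun w => hg.aestronglyMeasurable_exp_smul w)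
    (hg.integrable_exp_smul hz) (hg.smulRight.aestronglyMeasurable_exp_smul z)
    (Eventually.of_forall fun y w hw => ?_)
    ((hg.smulRight.2 _ (by positivity)).const_mul _)
    (Eventually.of_forall fun y w hw => ?_)
  · rw [norm_smul, Real.norm_of_nonneg (Real.exp_nonneg _), ← mul_assoc, ← Real.exp_add]
    gcongr
    exact gaussianForm_le (by positivity) hw.1.le hw.2.le y
  · have h := ((gaussianForm y).hasFDerivAt (x := w)).exp.smul_const (g y)
    convert h using 1
    ext v <;> simp [smul_smul]

/-- The derivative is again a transform, with values in a space of linear maps; hence the induction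
varies F, and F shares the universe of E so that this space is admissible. -/
theorem GaussianIntegrable.contDiffOn {F : Type u} [NormedAddCommGroup F] [NormedSpace ℝ F]
    {g : E → F} (hg : GaussianIntegrable μ g) (n : ℕ) :
    ContDiffOn ℝ n (gaussianTransform μ g) {z | 0 < z.2} := by
  induction n generalizing F with
  | zero =>
    exact contDiffOn_zero.2 fun z hz => (hg.hasFDerivAt hz).continuousAt.continuousWithinAt
  | succ n ih =>
    rw [Nat.cast_succ, contDiffOn_succ_iff_fderiv_of_isOpen (isOpen_lt continuous_const continuous_snd)]
    refine ⟨fun z hz => (hg.hasFDerivAt hz).differentiableAt.differentiableWithinAt, by simp, ?_⟩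
    exact (ih hg.smulRight).congr fun z hz => (hg.hasFDerivAt hz).fderiv

end GaussianTransform

/-! ### Joint regularity of noised densities and their scores at positive times. -/

section NoisedDensity

variable {d : ℕ} {κ : ℝ} {p : Space d → ℝ}

theorem noised_zero : noised κ p 0 = p := by
  funext x
  simp [noised]

/-- Expanding ‖x - y‖² separates a factor free of y; the rest depends on (s, x) only through
parameters that are smooth for s > 0. -/
theorem noised_eq_gaussianTransform (hκ : 0 < κ) {s : ℝ} (hs : 0 < s) (x : Space d) :
    noised κ p s x = (Real.sqrt (2 * Real.pi * (κ * s) ^ 2))⁻¹ ^ d *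
      Real.exp (-‖x‖ ^ 2 / (2 * (κ * s) ^ 2)) *
        gaussianTransform volume p (((κ * s) ^ 2)⁻¹ • x, (2 * (κ * s) ^ 2)⁻¹) := by
  have hτ : 0 < κ * s := by positivity
  rw [noised, if_neg hs.ne', gaussianTransform, ← integral_const_mul]
  congr 1
  funext y
  rw [gaussianDensity, gaussianForm_apply, smul_eq_mul, mul_assoc, mul_assoc, mul_assoc, ← mul_assoc
    (Real.exp _) (Real.exp _), ← Real.exp_add]
  congr 3
  rw [norm_sub_sq_real, inner_smul_right, real_inner_comm]
  field_simp
  ring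

theorem noised_pos (hκ : 0 < κ) (hp : ∀ x, 0 < p x) (hint : Integrable p) {s : ℝ} (hs : 0 < s)
    (x : Space d) : 0 < noised κ p s x := by
  have hτ : 0 < κ * s := by positivity
  rw [noised_eq_gaussianTransform hκ hs]
  have hz : 0 < (((κ * s) ^ 2)⁻¹ • x, (2 * (κ * s) ^ 2)⁻¹).2 := by
    show 0 < (2 * (κ * s) ^ 2)⁻¹
    positivity
  have h : 0 < gaussianTransform volume p (((κ * s) ^ 2)⁻¹ • x, (2 * (κ * s) ^ 2)⁻¹) := by
    have hpos : ∀ y, 0 < Real.exp (gaussianForm y (((κ * s) ^ 2)⁻¹ • x, (2 * (κ * s) ^ 2)⁻¹)) • p y :=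
      fun y => mul_pos (Real.exp_pos _) (hp y)
    rw [gaussianTransform, integral_pos_iff_support_of_nonneg (fun y => (hpos y).le)
      ((gaussianIntegrable_of_integrable hint).integrable_exp_smul hz)]
    have hsupp : Function.support (fun y => Real.exp (gaussianForm y
        (((κ * s) ^ 2)⁻¹ • x, (2 * (κ * s) ^ 2)⁻¹)) • p y) = univ :=
      eq_univ_of_forall fun y => (hpos y).ne'
    rw [hsupp]
    exact isOpen_univ.measure_pos volume univ_nonempty
  positivity

theorem contDiffOn_noised (hκ : 0 < κ) (hint : Integrable p) (n : ℕ) :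
    ContDiffOn ℝ n (fun z : ℝ × Space d => noised κ p z.1 z.2) (Ioi 0 ×ˢ univ) := by
  have hfst : ∀ z ∈ (Ioi 0 ×ˢ univ : Set (ℝ × Space d)), 0 < κ * z.1 :=
    fun z hz => mul_pos hκ hz.1
  have hs : ContDiffOn ℝ n (fun z : ℝ × Space d => (κ * z.1) ^ 2) (Ioi 0 ×ˢ univ) := by fun_prop
  refine ContDiffOn.congr ?_ fun z hz => noised_eq_gaussianTransform hκ hz.1 z.2
  refine ContDiffOn.mul (ContDiffOn.mul ?_ ?_) ?_
  · refine ContDiffOn.pow (ContDiffOn.inv (ContDiffOn.sqrt ?_ ?_) ?_) d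
    · fun_prop
    · intro z hz
      have := hfst z hz
      positivity
    · intro z hz
      have := hfst z hz
      positivity
  · refine ContDiffOn.exp (ContDiffOn.div ?_ ?_ ?_)
    · exact ((contDiff_norm_sq ℝ).comp contDiff_snd).neg.contDiffOn
    · fun_prop
    · intro z hz
      have := hfst z hz
      positivity
  · refine ContDiffOn.comp (t := {z : Space d × ℝ | 0 < z.2})
      ((gaussianIntegrable_of_integrable hint).contDiffOn n) ?_ ?_
    · refine ContDiffOn.prodMk (ContDiffOn.smul (hs.inv ?_) contDiff_snd.contDiffOn)
        (ContDiffOn.inv (by fun_prop) ?_)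
      · intro z hz
        have := hfst z hz
        positivity
      · intro z hz
        have := hfst z hz
        positivity
    · intro z hz
      have := hfst z hz
      show 0 < (2 * (κ * z.1) ^ 2)⁻¹
      positivity

theorem isOpen_Ioi_prod_univ {X : Type*} [TopologicalSpace X] :
    IsOpen (Ioi (0 : ℝ) ×ˢ (univ : Set X)) :=
  isOpen_Ioi.prod isOpen_univ

theorem contDiffOn_pfField (hκ : 0 < κ) (hp : ∀ x, 0 < p x) (hint : Integrable p) (σmax : ℝ) :
    ContDiffOn ℝ 1 (fun z : ℝ × Space d => pfField σmax κ p z.1 z.2) (Ioi 0 ×ˢ univ) := by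
  have hlog : ContDiffOn ℝ 2 (fun z : ℝ × Space d => Real.log (noised κ p z.1 z.2))
      (Ioi 0 ×ˢ univ) :=
    (contDiffOn_noised hκ hint 2).log fun z hz => (noised_pos hκ hp hint hz.1 z.2).ne'
  have hfd := ((contDiffOn_succ_iff_fderiv_of_isOpen (n := 1) isOpen_Ioi_prod_univ).1
    (by simpa [one_add_one_eq_two] using hlog)).2.2
  have hscore : ContDiffOn ℝ 1 (fun z : ℝ × Space d => score (noised κ p z.1) z.2)
      (Ioi 0 ×ˢ univ) := by
    -- The spatial gradient is the joint derivative restricted to space directions, so it inherits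
    -- joint regularity in (s, x).
    refine ContDiffOn.congr (f := fun z => (InnerProductSpace.toDual ℝ (Space d)).symm
      ((fderiv ℝ (fun z : ℝ × Space d => Real.log (noised κ p z.1 z.2)) z).comp
        (ContinuousLinearMap.inr ℝ ℝ (Space d)))) ?_ fun z hz => ?_
    · exact (InnerProductSpace.toDual ℝ (Space d)).symm.contDiff.comp_contDiffOn
        (hfd.clm_comp contDiffOn_const)
    · have hd : DifferentiableAt ℝ (fun z : ℝ × Space d => Real.log (noised κ p z.1 z.2)) z :=
        (hlog.contDiffAt (isOpen_Ioi_prod_univ.mem_nhds hz)).differentiableAt (by norm_num)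
      have hc := HasFDerivAt.comp (f := fun x => (z.1, x)) z.2 hd.hasFDerivAt
        (hasFDerivAt_prodMk_right z.1 z.2)
      rw [score, gradient]
      congr 1
      exact hc.fderiv
  unfold pfField
  exact (ContDiffOn.smul (contDiff_const.mul contDiff_fst).contDiffOn hscore).neg

end NoisedDensity

/-! ### Integrability of the unconditional density. -/

section Marginal

variable {d : ℕ} {C : Type*} [MeasurableSpace C] {ν : Measure C}

theorem ClassData.integrable_marginal [SigmaFinite ν] (D : ClassData d C ν) :
    Integrable D.marginal := by
  -- A non-integrable function has integral 0 by convention, so an integral equal to 1 forces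
  -- integrability.
  have hprior : Integrable D.prior ν := by
    by_contra h
    have := D.prior_integral
    rw [integral_undef h] at this
    exact zero_ne_one this
  have hcond : ∀ c, Integrable (D.cond c) := fun c => by
    by_contra h
    have := D.cond_integral c
    rw [integral_undef h] at this
    exact zero_ne_one this
  have hmeas : Measurable (fun z : C × Space d => D.prior z.1 * D.cond z.1 z.2) :=
    (D.prior_measurable.comp measurable_fst).mul D.cond_measurable
  have h : Integrable (fun z : C × Space d => D.prior z.1 * D.cond z.1 z.2) (ν.prod volume) := by
    rw [integrable_prod_iff hmeas.aestronglyMeasurable]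
    refine ⟨Eventually.of_forall fun c => (hcond c).const_mul (D.prior c), ?_⟩
    refine hprior.congr (Eventually.of_forall fun c => ?_)
    have hn : ∀ y, ‖D.prior c * D.cond c y‖ = D.prior c * D.cond c y := fun y =>
      Real.norm_of_nonneg (mul_nonneg (D.prior_nonneg c) (D.cond_nonneg c y))
    simp only [hn, integral_const_mul, D.cond_integral, mul_one]
  exact h.integral_prod_right

end Marginal

/-! ### Lipschitz trajectories on short time intervals. -/

section Trajectories

variable {E : Type*} [NormedAddCommGroup E] [NormedSpace ℝ E]

/-- `α` solves `dα/ds = v_s(α(s))` on the time set `I`. -/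
def IsTrajectory (v : ℝ → E → E) (I : Set ℝ) (α : ℝ → E) : Prop :=
  ∀ s ∈ I, HasDerivWithinAt α (v s (α s)) I s

theorem IsTrajectory.mono {v : ℝ → E → E} {I J : Set ℝ} {α : ℝ → E} (h : IsTrajectory v I α)
    (hJ : J ⊆ I) : IsTrajectory v J α :=
  fun s hs => (h s (hJ hs)).mono hJ

theorem IsTrajectory.continuousOn {v : ℝ → E → E} {I : Set ℝ} {α : ℝ → E}
    (h : IsTrajectory v I α) : ContinuousOn α I :=
  fun s hs => (h s hs).continuousWithinAt

/-- A linear differential inequality on a short interval, in both time directions. -/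
theorem norm_le_of_norm_deriv_le_affine {w w' : ℝ → E} {l u a K e : ℝ} (hK : 0 ≤ K) (he : 0 ≤ e)
    (hshort : K * (u - l) ≤ 1 / 2) (ha : a ∈ Icc l u)
    (hw : ∀ s ∈ Icc l u, HasDerivWithinAt w (w' s) (Icc l u) s)
    (hb : ∀ s ∈ Icc l u, ‖w' s‖ ≤ K * ‖w s‖ + e) {s : ℝ} (hs : s ∈ Icc l u) :
    ‖w s‖ ≤ 2 * (‖w a‖ + e * (u - l)) := by
  have hcont : ContinuousOn (fun s => ‖w s‖) (Icc l u) :=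
    ContinuousOn.norm fun s hs => (hw s hs).continuousWithinAt
  -- At a maximum point m of ‖w‖, the mean value inequality bounds ‖w m‖ by ‖w a‖ + ‖w m‖ / 2 + e (u
  -- - l), and half of ‖w m‖ is absorbed on the left. Nothing depends on the direction of time.
  obtain ⟨m, hm, hmax⟩ := isCompact_Icc.exists_isMaxOn ⟨a, ha⟩ hcont
  have hmv := (convex_Icc l u).norm_image_sub_le_of_norm_hasDerivWithin_le (C := K * ‖w m‖ + e) hw
    (fun s hs => (hb s hs).trans (by gcongr; exact hmax hs)) ha hm
  have habs : ‖m - a‖ ≤ u - l := by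
    rw [Real.norm_eq_abs, abs_le]
    constructor <;> linarith [ha.1, ha.2, hm.1, hm.2]
  have h1 : (K * ‖w m‖ + e) * ‖m - a‖ ≤ (K * ‖w m‖ + e) * (u - l) := by gcongr
  have h2 : K * (u - l) * ‖w m‖ ≤ 1 / 2 * ‖w m‖ := by gcongr
  have h3 : ‖w m‖ ≤ ‖w a‖ + ‖w m - w a‖ := norm_le_insert' _ _
  have h4 : ‖w s‖ ≤ ‖w m‖ := hmax hs
  nlinarith

variable {v : ℝ → E → E} {K : ℝ≥0} {l u a : ℝ}

theorem IsTrajectory.hasDerivWithinAt_sub {I : Set ℝ} {α β : ℝ → E} (hα : IsTrajectory v I α)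
    (hβ : IsTrajectory v I β) :
    ∀ s ∈ I, HasDerivWithinAt (fun s => α s - β s) (v s (α s) - v s (β s)) I s :=
  fun s hs => (hα s hs).sub (hβ s hs)

theorem IsTrajectory.norm_sub_le (hlip : ∀ s ∈ Icc l u, LipschitzWith K (v s))
    (hshort : K * (u - l) ≤ 1 / 2) {α β : ℝ → E} (hα : IsTrajectory v (Icc l u) α)
    (hβ : IsTrajectory v (Icc l u) β) (ha : a ∈ Icc l u) {s : ℝ} (hs : s ∈ Icc l u) :
    ‖α s - β s‖ ≤ 2 * ‖α a - β a‖ := by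
  have h := norm_le_of_norm_deriv_le_affine K.2 le_rfl hshort ha (hα.hasDerivWithinAt_sub hβ)
    (fun s hs => by simpa using (hlip s hs).norm_sub_le (α s) (β s)) hs
  simpa using h

/-- Over a time |s - a| the flow acts on differences as the identity up to a relative error 2K|s -
a|. This one estimate handles the passage to time 0, the bound on M_t - id and the transport of γ.
-/
theorem IsTrajectory.norm_sub_sub_le (hlip : ∀ s ∈ Icc l u, LipschitzWith K (v s))
    (hshort : K * (u - l) ≤ 1 / 2) {α β : ℝ → E} (hα : IsTrajectory v (Icc l u) α)
    (hβ : IsTrajectory v (Icc l u) β) (ha : a ∈ Icc l u) {s : ℝ} (hs : s ∈ Icc l u) :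
    ‖(α s - β s) - (α a - β a)‖ ≤ 2 * K * |s - a| * ‖α a - β a‖ := by
  have h := (convex_Icc l u).norm_image_sub_le_of_norm_hasDerivWithin_le
    (C := K * (2 * ‖α a - β a‖)) (hα.hasDerivWithinAt_sub hβ)
    (fun s hs => ((hlip s hs).norm_sub_le _ _).trans
      (by gcongr; exact hα.norm_sub_le hlip hshort hβ ha hs)) ha hs
  rw [Real.norm_eq_abs] at h
  linarith

theorem IsTrajectory.eq (hlip : ∀ s ∈ Icc l u, LipschitzWith K (v s))
    (hshort : K * (u - l) ≤ 1 / 2) {α β : ℝ → E} (hα : IsTrajectory v (Icc l u) α)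
    (hβ : IsTrajectory v (Icc l u) β) (ha : a ∈ Icc l u) (hab : α a = β a) {s : ℝ}
    (hs : s ∈ Icc l u) : α s = β s := by
  have h := hα.norm_sub_le hlip hshort hβ ha hs
  rw [hab, sub_self, norm_zero, mul_zero] at h
  exact sub_eq_zero.1 (norm_le_zero_iff.1 h)

theorem exists_isTrajectory [CompleteSpace E] (hlip : ∀ s ∈ Icc l u, LipschitzWith K (v s))
    (hshort : K * (u - l) ≤ 1 / 2) (hcont : ∀ x, ContinuousOn (fun s => v s x) (Icc l u))
    (ha : a ∈ Icc l u) (x : E) : ∃ α, α a = x ∧ IsTrajectory v (Icc l u) α := by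
  obtain ⟨M, hM⟩ := isCompact_Icc.exists_bound_of_continuousOn (hcont x)
  have hM0 : 0 ≤ M := (norm_nonneg _).trans (hM a ha)
  have hlu : 0 ≤ u - l := by linarith [ha.1, ha.2]
  lift M to ℝ≥0 using hM0
  set δ : ℝ≥0 := ⟨u - l, hlu⟩ with hδ
  have hδc : (δ : ℝ) = u - l := rfl
  -- With M bounding the field at x, the ball of radius 2Mδ is large enough: the speed there is at
  -- most M + 2KMδ, and Kδ ≤ 1/2 gives (M + 2KMδ)δ ≤ 2Mδ.
  have hPL : IsPicardLindelof v (⟨a, ha⟩ : Icc l u) x (2 * M * δ) 0 (M + K * (2 * M * δ)) K := by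
    refine ⟨fun t ht => (hlip t ht).lipschitzOnWith, fun y _ => hcont y, fun t ht y hy => ?_, ?_⟩
    · have h1 := (hlip t ht).norm_sub_le y x
      have h2 : ‖y - x‖ ≤ 2 * M * δ := by simpa [dist_eq_norm] using hy
      have h3 : ‖v t y‖ ≤ ‖v t x‖ + ‖v t y - v t x‖ := norm_le_insert' _ _
      have h4 : (K : ℝ) * ‖y - x‖ ≤ K * (2 * M * δ) := by gcongr
      push_cast
      linarith [hM t ht]
    · have h1 : max (u - a) (a - l) ≤ δ := by
        rw [hδc]
        exact max_le (by linarith [ha.1]) (by linarith [ha.2])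
      have h2 : (K : ℝ) * δ ≤ 1 / 2 := hshort
      have h3 : (M + K * (2 * M * δ) : ℝ) * max (u - a) (a - l) ≤ (M + K * (2 * M * δ)) * δ := by
        gcongr
      have h4 : (K * δ : ℝ) * (2 * M * δ) ≤ 1 / 2 * (2 * M * δ) := by gcongr
      push_cast
      linarith
  exact hPL.exists_eq_forall_mem_Icc_hasDerivWithinAt₀

end Trajectories

/-! ### Differentiability of the flow in its starting point. -/

section Differentiability

variable {E : Type*} [NormedAddCommGroup E] [NormedSpace ℝ E]

/-- A map which is approximated by linear maps at a point to every relative precision is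
differentiable there. -/
theorem differentiableAt_of_forall_exists_approx {F : Type*} [NormedAddCommGroup F]
    [NormedSpace ℝ F] [CompleteSpace F] {f : E → F} {y : E}
    (h : ∀ ε > 0, ∃ L : E →L[ℝ] F, ∀ᶠ x in 𝓝 y, ‖f x - f y - L (x - y)‖ ≤ ε * ‖x - y‖) :
    DifferentiableAt ℝ f y := by
  choose! L hL using h
  -- Two linear maps approximating the same increments are close to each other; hence the
  -- approximations form a Cauchy family, whose limit is the derivative.
  have hdist : ∀ ε > 0, ∀ η > 0, ‖L ε - L η‖ ≤ ε + η := by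
    intro ε hε η hη
    refine ContinuousLinearMap.opNorm_le_of_nhds_zero (by positivity) ?_
    have htend : Tendsto (fun z : E => y + z) (𝓝 0) (𝓝 y) := by
      simpa using (continuous_const_add y).tendsto 0
    filter_upwards [htend.eventually (hL ε hε), htend.eventually (hL η hη)] with z h1 h2
    rw [add_sub_cancel_left] at h1 h2
    have h3 : (L ε - L η) z = (f (y + z) - f y - L η z) - (f (y + z) - f y - L ε z) := by
      rw [sub_apply]; abel
    rw [h3]
    linarith [norm_sub_le (f (y + z) - f y - L η z) (f (y + z) - f y - L ε z)]
  have hε : ∀ n : ℕ, (0 : ℝ) < 1 / ((n : ℝ) + 1) := fun n => Nat.one_div_pos_of_nat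
  have hcauchy : CauchySeq fun n : ℕ => L (1 / ((n : ℝ) + 1)) := by
    refine cauchySeq_of_le_tendsto_0 (fun n : ℕ => 2 * (1 / ((n : ℝ) + 1))) (fun n m N hn hm => ?_) ?_
    · rw [dist_eq_norm]
      have h1 : 1 / ((n : ℝ) + 1) ≤ 1 / ((N : ℝ) + 1) := Nat.one_div_le_one_div hn
      have h2 : 1 / ((m : ℝ) + 1) ≤ 1 / ((N : ℝ) + 1) := Nat.one_div_le_one_div hm
      linarith [hdist _ (hε n) _ (hε m)]
    · simpa using (tendsto_one_div_add_atTop_nhds_zero_nat (𝕜 := ℝ)).const_mul 2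
  obtain ⟨L', hL'⟩ := cauchySeq_tendsto_of_complete hcauchy
  refine HasFDerivAt.differentiableAt (f' := L') (.of_isLittleO (isLittleO_iff.2 fun c hc => ?_))
  have h1 : ∀ᶠ n : ℕ in atTop, ‖L (1 / ((n : ℝ) + 1)) - L'‖ < c / 2 := by
    simpa [dist_eq_norm] using Metric.tendsto_nhds.1 hL' (c / 2) (by positivity)
  have h2 : ∀ᶠ n : ℕ in atTop, 1 / ((n : ℝ) + 1) < c / 2 :=
    tendsto_one_div_add_atTop_nhds_zero_nat.eventually_lt_const (by positivity)
  obtain ⟨n, hn1, hn2⟩ := (h1.and h2).exists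
  filter_upwards [hL _ (hε n)] with x hx
  set Ln := L (1 / ((n : ℝ) + 1))
  have h3 : f x - f y - L' (x - y) = (f x - f y - Ln (x - y)) + (Ln - L') (x - y) := by
    rw [sub_apply]; abel
  rw [h3]
  have h4 := (Ln - L').le_opNorm (x - y)
  have h5 : ‖Ln - L'‖ * ‖x - y‖ ≤ c / 2 * ‖x - y‖ := by gcongr
  have h6 : 1 / ((n : ℝ) + 1) * ‖x - y‖ ≤ c / 2 * ‖x - y‖ := by gcongr
  linarith [norm_add_le (f x - f y - Ln (x - y)) ((Ln - L') (x - y))]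

variable {v : ℝ → E → E} {A : ℝ → E → E →L[ℝ] E} {K : ℝ≥0} {l u a b : ℝ}

/-- Linearization of a differentiable vector field along a compact piece of a curve, uniformly in
time. -/
theorem exists_linearization_along_curve {φ : ℝ → E} (hφ : ContinuousOn φ (Icc l u))
    (hA : ∀ s ∈ Icc l u, ∀ x, HasFDerivAt (v s) (A s x) x)
    (hAc : ∀ s ∈ Icc l u, ∀ x, ContinuousAt (Function.uncurry A) (s, x)) {ε : ℝ} (hε : 0 < ε) :
    ∃ r > 0, ∀ s ∈ Icc l u, ∀ x, ‖x - φ s‖ < r →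
      ‖v s x - v s (φ s) - A s (φ s) (x - φ s)‖ ≤ ε * ‖x - φ s‖ := by
  have hcpt : IsCompact ((fun s => (s, φ s)) '' Icc l u) :=
    isCompact_Icc.image_of_continuousOn (continuousOn_id.prodMk hφ)
  have hcA : ∀ z ∈ (fun s => (s, φ s)) '' Icc l u, ContinuousAt (Function.uncurry A) z := by
    rintro _ ⟨s, hs, rfl⟩
    exact hAc s hs _
  -- Compactness of the graph of φ gives one radius valid at all times.
  have hu := hcpt.uniformContinuousAt_of_continuousAt _ hcA (Metric.dist_mem_uniformity hε)
  obtain ⟨r, hr, hrsub⟩ := Metric.mem_uniformity_dist.1 hu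
  refine ⟨r, hr, fun s hs x hx => ?_⟩
  refine (convex_ball (φ s) r).norm_image_sub_le_of_norm_hasFDerivWithin_le' (f' := A s)
    (fun z _ => (hA s hs z).hasFDerivWithinAt) (fun z hz => ?_) (Metric.mem_ball_self hr)
    (by simpa [dist_eq_norm] using hx)
  have hd : dist (s, φ s) (s, z) < r := by
    rw [Prod.dist_eq, dist_self, dist_comm]
    exact max_lt hr hz
  have h : dist (A s (φ s)) (A s z) < ε := by
    have hmem := hrsub hd
    simp only [mem_ofPred_eq] at hmem
    exact hmem (mem_image_of_mem _ hs)
  rw [dist_comm, dist_eq_norm] at h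
  exact h.le

/-- The linear map solves the variational equation J' = A(s, φ(s)) ∘ J with J(a) = id. -/
theorem IsTrajectory.exists_linear_approx [CompleteSpace E]
    (hlip : ∀ s ∈ Icc l u, LipschitzWith K (v s)) (hshort : K * (u - l) ≤ 1 / 2)
    (hA : ∀ s ∈ Icc l u, ∀ x, HasFDerivAt (v s) (A s x) x)
    (hAc : ∀ s ∈ Icc l u, ∀ x, ContinuousAt (Function.uncurry A) (s, x))
    {φ : ℝ → E} (hφ : IsTrajectory v (Icc l u) φ) (ha : a ∈ Icc l u) (hb : b ∈ Icc l u)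
    {ε : ℝ} (hε : 0 < ε) :
    ∃ L : E →L[ℝ] E, ∃ r > 0, ∀ ψ, IsTrajectory v (Icc l u) ψ → ‖ψ a - φ a‖ < r →
      ‖ψ b - φ b - L (ψ a - φ a)‖ ≤ ε * ‖ψ a - φ a‖ := by
  have hlu : 0 ≤ u - l := by linarith [ha.1, ha.2]
  have hAK : ∀ s ∈ Icc l u, ∀ x, ‖A s x‖ ≤ K := fun s hs x => (hA s hs x).le_of_lipschitz (hlip s hs)
  have hAφ : ContinuousOn (fun s => A s (φ s)) (Icc l u) := fun s hs =>
    ContinuousAt.comp_continuousWithinAt (f := fun s => (s, φ s)) (hAc s hs (φ s))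
      (continuousWithinAt_id.prodMk (hφ s hs).continuousWithinAt)
  obtain ⟨J, hJa, hJ⟩ := exists_isTrajectory (K := K)
    (v := fun s (B : E →L[ℝ] E) => (A s (φ s)).comp B)
    (fun s hs => LipschitzWith.of_dist_le_mul fun B B' => by
      rw [dist_eq_norm, dist_eq_norm, ← ContinuousLinearMap.comp_sub]
      exact (ContinuousLinearMap.opNorm_comp_le _ _).trans (by gcongr; exact hAK s hs _))
    hshort (fun B => hAφ.clm_comp continuousOn_const) ha (ContinuousLinearMap.id ℝ E)
  -- The error estimate below multiplies this precision by 4(u - l); the added 1 covers u = l. The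
  -- radius is then halved because trajectories may separate by a factor 2.
  obtain ⟨r, hr, hlin⟩ := exists_linearization_along_curve hφ.continuousOn hA hAc
    (ε := ε / (4 * (u - l) + 1)) (by positivity)
  refine ⟨J b, r / 2, by positivity, fun ψ hψ hclose => ?_⟩
  set h := ψ a - φ a with hh
  have hsub : ∀ s ∈ Icc l u, ‖ψ s - φ s‖ ≤ 2 * ‖h‖ := fun s hs =>
    hψ.norm_sub_le hlip hshort hφ ha hs
  have hw : ∀ s ∈ Icc l u, HasDerivWithinAt (fun s => ψ s - φ s - J s h)
      (v s (ψ s) - v s (φ s) - A s (φ s) (J s h)) (Icc l u) s := fun s hs => by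
    have h1 := (hJ s hs).clm_apply (hasDerivWithinAt_const s (Icc l u) h)
    exact ((hψ.hasDerivWithinAt_sub hφ s hs).sub h1).congr_deriv (by simp)
  have hest := norm_le_of_norm_deriv_le_affine (K := K) (e := ε / (4 * (u - l) + 1) * (2 * ‖h‖))
    K.2 (by positivity) hshort ha hw (fun s hs => ?_) hb
  · have hwa : ψ a - φ a - J a h = 0 := by rw [hJa]; simp [hh]
    simp only [hwa, norm_zero, zero_add] at hest
    refine hest.trans ?_
    have h1 : 2 * (ε / (4 * (u - l) + 1) * (2 * ‖h‖) * (u - l))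
        = ε * ‖h‖ * ((4 * (u - l)) / (4 * (u - l) + 1)) := by
      field_simp; ring
    rw [h1]
    refine mul_le_of_le_one_right (by positivity) ((div_le_one (by positivity)).2 (by linarith))
  · have h1 := hlin s hs (ψ s) (by linarith [hsub s hs])
    have h2 : v s (ψ s) - v s (φ s) - A s (φ s) (J s h) =
        A s (φ s) (ψ s - φ s - J s h) +
          (v s (ψ s) - v s (φ s) - A s (φ s) (ψ s - φ s)) := by
      rw [map_sub (A s (φ s)) (ψ s - φ s)]; abel
    rw [h2]
    refine (norm_add_le _ _).trans (add_le_add ?_ (h1.trans ?_))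
    · exact ((A s (φ s)).le_opNorm _).trans (by gcongr; exact hAK s hs _)
    · have := hsub s hs
      gcongr

/-- The time-zero value of the flow of a vector field which is differentiable at positive times
only is differentiable in the starting point. -/
theorem differentiableAt_flow_to_zero [CompleteSpace E] {T : ℝ}
    (hlip : ∀ s ∈ Icc 0 T, LipschitzWith K (v s)) (hshort : K * T ≤ 1 / 2)
    (hA : ∀ s, 0 < s → ∀ x, HasFDerivAt (v s) (A s x) x)
    (hAc : ∀ s, 0 < s → ∀ x, ContinuousAt (Function.uncurry A) (s, x))
    (ha : a ∈ Ioc 0 T) {Φ : E → ℝ → E}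
    (hΦ : ∀ x, Φ x a = x ∧ IsTrajectory v (Icc 0 T) (Φ x)) (y : E) :
    DifferentiableAt ℝ (fun x => Φ x 0) y := by
  refine differentiableAt_of_forall_exists_approx fun ε hε => ?_
  -- Linearization is used only on [δ, T], with error ε/2. Crossing [0, δ] costs at most 2Kδ · 2‖x -
  -- y‖, the other half.
  obtain ⟨δ, hδ0, hδa, hδε⟩ : ∃ δ, 0 < δ ∧ δ ≤ a ∧ 4 * K * δ ≤ ε / 2 := by
    refine ⟨min a (ε / (8 * (K + 1))), lt_min ha.1 (by positivity), min_le_left _ _, ?_⟩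
    calc 4 * K * min a (ε / (8 * (K + 1))) ≤ 4 * (K + 1) * (ε / (8 * (K + 1))) := by
          have h1 : 0 ≤ min a (ε / (8 * ((K : ℝ) + 1))) := le_min ha.1.le (by positivity)
          have h2 : (K : ℝ) ≤ K + 1 := by linarith
          have h3 := min_le_right a (ε / (8 * ((K : ℝ) + 1)))
          gcongr
      _ = ε / 2 := by field_simp; ring
  have hsub : Icc δ T ⊆ Icc 0 T := Icc_subset_Icc_left hδ0.le
  have hshort0 : K * (T - 0) ≤ 1 / 2 := by rwa [sub_zero]
  have hshortδ : K * (T - δ) ≤ 1 / 2 := by nlinarith [K.2]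
  have hδT : δ ∈ Icc δ T := ⟨le_rfl, hδa.trans ha.2⟩
  have ha0 : a ∈ Icc 0 T := ⟨ha.1.le, ha.2⟩
  obtain ⟨L, r, hr, hL⟩ := ((hΦ y).2.mono hsub).exists_linear_approx
    (fun s hs => hlip s (hsub hs)) hshortδ (fun s hs => hA s (hδ0.trans_le hs.1))
    (fun s hs => hAc s (hδ0.trans_le hs.1)) (a := a) ⟨hδa, ha.2⟩ hδT (half_pos hε)
  refine ⟨L, Metric.eventually_nhds_iff.2 ⟨r, hr, fun x hx => ?_⟩⟩
  rw [dist_eq_norm] at hx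
  have h1 := hL (Φ x) ((hΦ x).2.mono hsub)
  rw [(hΦ x).1, (hΦ y).1] at h1
  have h2 := (hΦ x).2.norm_sub_sub_le hlip hshort0 (hΦ y).2 (hsub hδT)
    ⟨le_rfl, hδ0.le.trans hδT.2⟩
  rw [zero_sub, abs_neg, abs_of_pos hδ0] at h2
  have h3 := (hΦ x).2.norm_sub_le hlip hshort0 (hΦ y).2 ha0 (hsub hδT)
  rw [(hΦ x).1, (hΦ y).1] at h3
  have h4 : 2 * K * δ * ‖Φ x δ - Φ y δ‖ ≤ 2 * K * δ * (2 * ‖x - y‖) := by gcongr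
  have h5 : 4 * K * δ * ‖x - y‖ ≤ ε / 2 * ‖x - y‖ := by gcongr
  have h6 : Φ x 0 - Φ y 0 - L (x - y) =
      (Φ x 0 - Φ y 0 - (Φ x δ - Φ y δ)) + (Φ x δ - Φ y δ - L (x - y)) := by abel
  rw [h6]
  linarith [norm_add_le (Φ x 0 - Φ y 0 - (Φ x δ - Φ y δ)) (Φ x δ - Φ y δ - L (x - y)), h1 hx]

/-- The derivative of the flow to time zero is close to the identity. -/
theorem norm_fderiv_flow_to_zero_sub_id_le {T : ℝ}
    (hlip : ∀ s ∈ Icc 0 T, LipschitzWith K (v s)) (hshort : K * T ≤ 1 / 2)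
    (ha : a ∈ Icc 0 T) {Φ : E → ℝ → E}
    (hΦ : ∀ x, Φ x a = x ∧ IsTrajectory v (Icc 0 T) (Φ x)) {y : E} {L : E →L[ℝ] E}
    (hL : HasFDerivAt (fun x => Φ x 0) L y) :
    ‖L - ContinuousLinearMap.id ℝ E‖ ≤ 2 * K * a := by
  have hnn : 0 ≤ 2 * K * a := by have := ha.1; positivity
  refine (hL.sub (hasFDerivAt_id y)).le_of_lip' hnn (Eventually.of_forall fun x => ?_)
  have h := (hΦ x).2.norm_sub_sub_le hlip (by rwa [sub_zero]) (hΦ y).2 ha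
    ⟨le_rfl, ha.1.trans ha.2⟩
  rw [(hΦ x).1, (hΦ y).1, zero_sub, abs_neg, abs_of_nonneg ha.1] at h
  have h2 : Φ x 0 - x - (Φ y 0 - y) = Φ x 0 - Φ y 0 - (x - y) := by abel
  simpa [h2] using h

/-- Transporting a curve `γ` along the flow of `v` to a fixed time `t` gives a curve whose velocity
at `t` is the velocity of `γ` relative to `v`. -/
theorem hasDerivWithinAt_flow_to_time (hlip : ∀ s ∈ Icc l u, LipschitzWith K (v s))
    (hshort : K * (u - l) ≤ 1 / 2) {Φ : ℝ → E → ℝ → E}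
    (hΦ : ∀ τ ∈ Icc l u, ∀ x, Φ τ x τ = x ∧ IsTrajectory v (Icc l u) (Φ τ x)) {t : ℝ}
    (ht : t ∈ Icc l u) {γ : ℝ → E} {γ' : E} (hγ : HasDerivWithinAt γ γ' (Icc l u) t) :
    HasDerivWithinAt (fun τ => Φ τ (γ τ) t) (γ' - v t (γ t)) (Icc l u) t := by
  obtain ⟨hφt, hφ⟩ := hΦ t ht (γ t)
  set φ := Φ t (γ t)
  have hrel : HasDerivWithinAt (fun τ => γ τ - φ τ) (γ' - v t (γ t)) (Icc l u) t := by
    have := hγ.sub (hφ t ht)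
    rwa [hφt] at this
  have hzero : Tendsto (fun τ => γ τ - φ τ) (𝓝[Icc l u] t) (𝓝 0) := by
    have := hrel.continuousWithinAt.tendsto
    rwa [hφt, sub_self] at this
  -- Between times τ and t the separation of the two v-trajectories changes by at most 2K|τ - t| ‖γ
  -- τ - φ τ‖, which is o(τ - t) because γ and φ meet at t.
  have herr : HasDerivWithinAt (fun τ => Φ τ (γ τ) t - φ t - (γ τ - φ τ)) 0 (Icc l u) t := by
    rw [hasDerivWithinAt_iff_isLittleO]
    have hval : Φ t (γ t) t - φ t - (γ t - φ t) = 0 := by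
      rw [hφt, (hΦ t ht (γ t)).1]; simp
    simp only [hval, sub_zero, smul_zero]
    have hbig : (fun τ => Φ τ (γ τ) t - φ t - (γ τ - φ τ)) =O[𝓝[Icc l u] t]
        fun τ => (τ - t) • (γ τ - φ τ) := by
      refine IsBigO.of_bound (2 * K) ?_
      filter_upwards [self_mem_nhdsWithin] with τ hτ
      have h := (hΦ τ hτ (γ τ)).2.norm_sub_sub_le hlip hshort hφ hτ ht
      rw [(hΦ τ hτ (γ τ)).1, abs_sub_comm] at h
      rw [norm_smul, Real.norm_eq_abs]
      linarith
    have hlittle : (fun τ => (τ - t) • (γ τ - φ τ)) =o[𝓝[Icc l u] t] fun τ => (τ - t) • (1 : ℝ) :=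
      (isBigO_refl _ _).smul_isLittleO ((isLittleO_one_iff ℝ).2 hzero)
    exact hbig.trans_isLittleO (by simpa using hlittle)
  have hsum := (herr.add hrel).add_const (φ t)
  rw [zero_add] at hsum
  refine hsum.congr_of_mem (fun τ _ => ?_) ht
  simp

end Differentiability

/-! ### Second-order expansion at time 0. -/

section SecondOrder

variable {E : Type*} [NormedAddCommGroup E] [NormedSpace ℝ E]

theorem nhdsWithin_Icc_zero_one : 𝓝[Icc (0 : ℝ) 1] 0 = 𝓝[≥] 0 :=
  nhdsWithin_Icc_eq_nhdsGE zero_lt_one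

theorem hasDerivWithinAt_derivWithin_zero {f f' : ℝ → E} {L : E}
    (hf : ∀ᶠ t in 𝓝[≥] (0 : ℝ), HasDerivWithinAt f (f' t) (Icc 0 1) t) (h0 : f' 0 = 0)
    (hL : (fun t => f' t - t • L) =o[𝓝[≥] (0 : ℝ)] fun t => t) :
    HasDerivWithinAt (derivWithin f (Icc 0 1)) L (Icc 0 1) 0 := by
  have hmem : ∀ᶠ t in 𝓝[≥] (0 : ℝ), t ∈ Icc (0 : ℝ) 1 := by
    rw [← nhdsWithin_Icc_zero_one]
    exact self_mem_nhdsWithin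
  have heq : ∀ᶠ t in 𝓝[≥] (0 : ℝ), derivWithin f (Icc 0 1) t = f' t := by
    filter_upwards [hf, hmem] with t ht ht1
    exact ht.derivWithin (uniqueDiffOn_Icc zero_lt_one t ht1)
  rw [hasDerivWithinAt_iff_isLittleO, nhdsWithin_Icc_zero_one]
  refine hL.congr' ?_ (Eventually.of_forall fun t => (sub_zero t).symm)
  filter_upwards [heq] with t ht
  rw [ht, heq.self_of_nhdsWithin self_mem_Ici, h0, sub_zero, sub_zero]

/-- Subtracting (t² / 2) L from f leaves derivative o(t), hence increment o(t²) by the mean value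
inequality; g divides it by t. -/
theorem mixedSignal_isLittleO {d : ℕ} {f f' : ℝ → Space d} {L : Space d}
    (hf : ∀ᶠ t in 𝓝[≥] (0 : ℝ), HasDerivWithinAt f (f' t) (Icc 0 1) t)
    (hL : (fun t => f' t - t • L) =o[𝓝[≥] (0 : ℝ)] fun t => t) :
    (fun t => mixedSignal f t - (f 0 - (t / 2) • L)) =o[𝓝[>] (0 : ℝ)] fun t => t := by
  rw [isLittleO_iff]
  intro ε hε
  obtain ⟨r, hr, hsub⟩ := mem_nhdsGE_iff_exists_Icc_subset.1
    ((hf.and (isLittleO_iff.1 hL hε)).and (nhdsWithin_Icc_zero_one ▸ self_mem_nhdsWithin :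
      ∀ᶠ t in 𝓝[≥] (0 : ℝ), t ∈ Icc (0 : ℝ) 1))
  filter_upwards [Ioc_mem_nhdsGT hr] with t ht
  have hpos : 0 < t := ht.1
  have hIcc : ∀ s ∈ Icc 0 t, s ∈ Icc 0 r := fun s hs => ⟨hs.1, hs.2.trans ht.2⟩
  have hsub1 : Icc 0 t ⊆ Icc (0 : ℝ) 1 := fun s hs => (hsub (hIcc s hs)).2
  have hder : ∀ s ∈ Icc 0 t,
      HasDerivWithinAt (fun s => f s - (s ^ 2 / 2) • L) (f' s - s • L) (Icc 0 t) s := by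
    intro s hs
    have h1 : HasDerivAt (fun s : ℝ => s ^ 2 / 2) s s := by
      simpa using ((hasDerivAt_id s).pow 2).div_const 2
    exact ((hsub (hIcc s hs)).1.1.mono hsub1).sub (h1.smul_const L).hasDerivWithinAt
  have hmv := (convex_Icc 0 t).norm_image_sub_le_of_norm_hasDerivWithin_le (C := ε * t) hder
    (fun s hs => ((hsub (hIcc s hs)).1.2).trans
      (by rw [Real.norm_of_nonneg hs.1]; exact mul_le_mul_of_nonneg_left hs.2 hε.le))
    (left_mem_Icc.2 hpos.le) (right_mem_Icc.2 hpos.le)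
  have hid : mixedSignal f t - (f 0 - (t / 2) • L) =
      -(t⁻¹ • ((f t - (t ^ 2 / 2) • L) - (f 0 - ((0 : ℝ) ^ 2 / 2) • L))) := by
    have h1 : (t / 2) • L = t⁻¹ • ((t ^ 2 / 2) • L) := by
      rw [smul_smul]
      congr 1
      field_simp
    rw [mixedSignal, h1]
    simp only [smul_sub, zero_pow two_ne_zero, zero_div, zero_smul, sub_zero]
    abel
  rw [hid, norm_neg, norm_smul, norm_inv, Real.norm_of_nonneg hpos.le]
  rw [sub_zero, Real.norm_of_nonneg hpos.le] at hmv
  rw [inv_mul_le_iff₀ hpos]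
  linarith

theorem isLittleO_clm_apply_smul {l : Filter ℝ} {M : ℝ → E →L[ℝ] E} {S : ℝ → E} {G : E}
    (hM : Tendsto M l (𝓝 (ContinuousLinearMap.id ℝ E))) (hS : Tendsto S l (𝓝 G)) (σ : ℝ) :
    (fun t => M t (-((σ * t) • S t)) - t • -(σ • G)) =o[l] fun t => t := by
  have hlim : Tendsto (fun t => M t (-(σ • S t)) - -(σ • G)) l (𝓝 0) := by
    have h := ((isBoundedBilinearMap_apply.continuous.tendsto
      (ContinuousLinearMap.id ℝ E, -(σ • G))).comp
        (hM.prodMk_nhds (hS.const_smul σ).neg)).sub_const (-(σ • G))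
    simpa [Function.comp_def] using h
  have h := (isBigO_refl (fun t : ℝ => t) l).smul_isLittleO ((isLittleO_one_iff ℝ).2 hlim)
  refine h.congr (fun t => ?_) fun t => by simp
  have hcomm : -((σ * t) • S t) = t • -(σ • S t) := by
    rw [smul_neg, smul_smul, mul_comm]
  rw [smul_sub, hcomm, map_smul]

end SecondOrder

/-! ### The solver and the derivative of the composed flows. -/

section Solver

variable {d : ℕ} {v : ℝ → Space d → Space d} {K : ℝ≥0} {T : ℝ}

/-- Uniqueness makes the solution chosen inside `solver` agree with any trajectory at hand. -/
theorem IsTrajectory.solver_eq (hlip : ∀ s ∈ Icc 0 T, LipschitzWith K (v s))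
    (hshort : K * T ≤ 1 / 2) {α : ℝ → Space d} (hα : IsTrajectory v (Icc 0 T) α) {a b : ℝ}
    (ha : a ∈ Icc 0 T) (hb : b ∈ Icc 0 T) : solver v a b (α a) = α b := by
  have hsub : uIcc a b ⊆ Icc 0 T := ordConnected_Icc.uIcc_subset ha hb
  have hsol : IsSolution v a b (α a) α := ⟨rfl, hα.mono hsub⟩
  have hex : ∃ γ, IsSolution v a b (α a) γ := ⟨α, hsol⟩
  rw [solver, dif_pos hex]
  have hlen : K * (max a b - min a b) ≤ 1 / 2 := by
    have h1 : max a b ≤ T := max_le ha.2 hb.2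
    have h2 : 0 ≤ min a b := le_min ha.1 hb.1
    have h3 : (K : ℝ) * (max a b - min a b) ≤ K * T := by
      gcongr
      linarith
    exact h3.trans hshort
  exact IsTrajectory.eq (fun s hs => hlip s (hsub hs)) hlen (fun s hs => hex.choose_spec.2 s hs)
    (hα.mono hsub) left_mem_uIcc hex.choose_spec.1 right_mem_uIcc

theorem solver_self (v : ℝ → Space d → Space d) (a : ℝ) (x : Space d) : solver v a a x = x := by
  rw [solver]
  split_ifs with h
  · exact h.choose_spec.1
  · rfl

/-- The composition of the flow of `v₁` from `0` to `t` with the flow of `v₂` back to `0`. -/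
theorem exists_hasDerivWithinAt_solver_comp {v₁ v₂ : ℝ → Space d → Space d}
    {A : ℝ → Space d → Space d →L[ℝ] Space d}
    (hlip₁ : ∀ s ∈ Icc 0 T, LipschitzWith K (v₁ s)) (hlip₂ : ∀ s ∈ Icc 0 T, LipschitzWith K (v₂ s))
    (hcont₁ : ∀ x, ContinuousOn (fun s => v₁ s x) (Icc 0 T))
    (hcont₂ : ∀ x, ContinuousOn (fun s => v₂ s x) (Icc 0 T))
    (hT : 0 ≤ T) (hshort : K * T ≤ 1 / 2)
    (hA : ∀ s, 0 < s → ∀ x, HasFDerivAt (v₂ s) (A s x) x)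
    (hAc : ∀ s, 0 < s → ∀ x, ContinuousAt (Function.uncurry A) (s, x)) (x₀ : Space d) :
    ∃ (γ : ℝ → Space d) (M : ℝ → Space d →L[ℝ] Space d), γ 0 = x₀ ∧
      ContinuousOn γ (Icc 0 T) ∧ ∀ t ∈ Icc 0 T,
        ‖M t - ContinuousLinearMap.id ℝ (Space d)‖ ≤ 2 * K * t ∧
        HasDerivWithinAt (fun t => solver v₂ t 0 (solver v₁ 0 t x₀))
          (M t (v₁ t (γ t) - v₂ t (γ t))) (Icc 0 T) t := by
  have hshort0 : K * (T - 0) ≤ 1 / 2 := by rwa [sub_zero]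
  have h0T : (0 : ℝ) ∈ Icc 0 T := ⟨le_rfl, hT⟩
  obtain ⟨γ, hγ0, hγ⟩ := exists_isTrajectory hlip₁ hshort0 hcont₁ h0T x₀
  choose! Φ hΦ using fun (τ : ℝ) (hτ : τ ∈ Icc 0 T) (x : Space d) =>
    exists_isTrajectory hlip₂ hshort0 hcont₂ hτ x
  have hsolver : ∀ t ∈ Icc 0 T, solver v₂ t 0 (solver v₁ 0 t x₀) = Φ t (γ t) 0 := by
    intro t ht
    rw [← hγ0, hγ.solver_eq hlip₁ hshort h0T ht]
    have h := (hΦ t ht (γ t)).2.solver_eq hlip₂ hshort ht h0T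
    rwa [(hΦ t ht (γ t)).1] at h
  have hdiff : ∀ t ∈ Icc 0 T, DifferentiableAt ℝ (fun x => Φ t x 0) (γ t) := by
    intro t ht
    rcases ht.1.eq_or_lt with rfl | hpos
    · have : (fun x => Φ 0 x 0) = id := funext fun x => (hΦ 0 h0T x).1
      rw [this]
      exact differentiableAt_id
    · exact differentiableAt_flow_to_zero hlip₂ hshort hA hAc ⟨hpos, ht.2⟩ (hΦ t ht) _
  refine ⟨γ, fun t => fderiv ℝ (fun x => Φ t x 0) (γ t), hγ0, hγ.continuousOn, fun t ht =>
    ⟨norm_fderiv_flow_to_zero_sub_id_le hlip₂ hshort ht (hΦ t ht) (hdiff t ht).hasFDerivAt, ?_⟩⟩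
  have hval : Φ t (γ t) t = γ t := (hΦ t ht (γ t)).1
  -- By uniqueness, flowing from τ to 0 is flowing from τ to t and then from t to 0. With t fixed
  -- the outer map does not depend on τ, so the ordinary chain rule applies.
  have htrans := hasDerivWithinAt_flow_to_time hlip₂ hshort0 hΦ ht (hγ t ht)
  have hfd : HasFDerivAt (fun x => Φ t x 0) (fderiv ℝ (fun x => Φ t x 0) (γ t)) (Φ t (γ t) t) := by
    rw [hval]
    exact (hdiff t ht).hasFDerivAt
  refine (HasFDerivAt.comp_hasDerivWithinAt (f := fun τ => Φ τ (γ τ) t) t hfd htrans).congr_of_mem (fun τ hτ => ?_) ht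
  rw [hsolver τ hτ]
  exact (hΦ τ hτ (γ τ)).2.eq hlip₂ hshort0 (hΦ t ht _).2 ht (hΦ t ht _).1.symm h0T

end Solver

/-! ### Probability flow fields and Bayes' rule for scores. -/

section ProbabilityFlow

variable {d : ℕ} {σmax κ : ℝ} {p : Space d → ℝ}

theorem RegularFlow.continuousOn_pfField (hp : RegularFlow σmax κ p) (x : Space d) :
    ContinuousOn (fun s => pfField σmax κ p s x) (Icc 0 1) := by
  have h : ContinuousOn (fun s => score (noised κ p s) x) (Icc 0 1) :=
    hp.continuous_score.comp (f := fun s : ℝ => (s, x)) (by fun_prop) fun s hs => ⟨hs, mem_univ x⟩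
  unfold pfField
  exact (ContinuousOn.smul (continuous_const.mul continuous_id).continuousOn h).neg

theorem exists_partial_fderiv_pfField (hκ : 0 < κ) (hp : ∀ x, 0 < p x) (hint : Integrable p) :
    ∃ A : ℝ → Space d → Space d →L[ℝ] Space d,
      (∀ s, 0 < s → ∀ x, HasFDerivAt (pfField σmax κ p s) (A s x) x) ∧
      ∀ s, 0 < s → ∀ x, ContinuousAt (Function.uncurry A) (s, x) := by
  have hC := contDiffOn_pfField hκ hp hint σmax
  refine ⟨fun s x => (fderiv ℝ (fun z : ℝ × Space d => pfField σmax κ p z.1 z.2) (s, x)).comp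
    (ContinuousLinearMap.inr ℝ ℝ (Space d)), fun s hs x => ?_, fun s hs x => ?_⟩
  · have hd : DifferentiableAt ℝ (fun z : ℝ × Space d => pfField σmax κ p z.1 z.2) (s, x) :=
      (hC.contDiffAt (isOpen_Ioi_prod_univ.mem_nhds (mk_mem_prod (mem_Ioi.2 hs) (mem_univ x)))).differentiableAt one_ne_zero
    exact HasFDerivAt.comp (f := fun x => (s, x)) x hd.hasFDerivAt (hasFDerivAt_prodMk_right s x)
  · have hc := (hC.continuousOn_fderiv_of_isOpen isOpen_Ioi_prod_univ le_rfl).continuousAt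
      (isOpen_Ioi_prod_univ.mem_nhds (mk_mem_prod (mem_Ioi.2 hs) (mem_univ x)))
    exact hc.clm_comp continuousAt_const

theorem gradient_log_posterior {C : Type*} [MeasurableSpace C] {ν : Measure C}
    (D : ClassData d C ν) {c : C} (hc : 0 < D.prior c) {x : Space d}
    (hcond : ∀ x, 0 < D.cond c x) (hcond' : DifferentiableAt ℝ (D.cond c) x)
    (hmarg : ∀ x, 0 < D.marginal x) (hmarg' : DifferentiableAt ℝ D.marginal x) :
    gradient (fun x => Real.log (D.posterior c x)) x = score (D.cond c) x - score D.marginal x := by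
  have hlog : (fun x => Real.log (D.posterior c x)) = fun x =>
      Real.log (D.prior c) + Real.log (D.cond c x) - Real.log (D.marginal x) := by
    funext y
    rw [ClassData.posterior, Real.log_div (mul_pos hc (hcond y)).ne' (hmarg y).ne',
      Real.log_mul hc.ne' (hcond y).ne']
  have h1 : HasGradientAt (fun y => Real.log (D.cond c y)) (score (D.cond c) x) x :=
    (hcond'.log (hcond x).ne').hasGradientAt
  have h2 : HasGradientAt (fun y => Real.log (D.marginal y)) (score D.marginal x) x :=
    (hmarg'.log (hmarg x).ne').hasGradientAt
  rw [hlog]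
  refine HasGradientAt.gradient ?_
  rw [hasGradientAt_iff_hasFDerivAt] at h1 h2 ⊢
  rw [map_sub]
  exact (h1.const_add _).sub h2

end ProbabilityFlow

end HybridFlow

/-! ### Expansion of the hybrid flow and the mixed signal. -/

theorem proposition2 {d : ℕ} {C : Type*} [MeasurableSpace C] (ν : Measure C) [SigmaFinite ν]
    (D : HybridFlow.ClassData d C ν) (σmax κ : ℝ) (hσ : 0 < σmax) (hκ : 0 < κ)
    (c : C) (hc : 0 < D.prior c)
    (hcond : HybridFlow.RegularFlow σmax κ (D.cond c))
    (hmarg : HybridFlow.RegularFlow σmax κ D.marginal)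
    (x₀ : HybridFlow.Space d) (f : ℝ → HybridFlow.Space d)
    (hf : f = HybridFlow.hybridFlow D σmax κ c x₀) :
    f 0 = x₀ ∧
    HasDerivWithinAt f 0 (Icc 0 1) 0 ∧
    (∀ᶠ t in 𝓝[≥] (0 : ℝ), DifferentiableWithinAt ℝ f (Icc 0 1) t) ∧
    HasDerivWithinAt (derivWithin f (Icc 0 1))
      (-(σmax • gradient (fun x => Real.log (D.posterior c x)) x₀)) (Icc 0 1) 0 ∧
    (fun t => HybridFlow.mixedSignal f t -
        (x₀ + (σmax * t / 2) • gradient (fun x => Real.log (D.posterior c x)) x₀))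
      =o[𝓝[>] (0 : ℝ)] (fun t => t) := by
  open HybridFlow in
  set G := gradient (fun x => Real.log (D.posterior c x)) x₀ with hG
  obtain ⟨K₁, hK₁⟩ := hcond.lipschitz
  obtain ⟨K₂, hK₂⟩ := hmarg.lipschitz
  set K := max K₁ K₂
  obtain ⟨T, hT0, hT1, hshort⟩ : ∃ T : ℝ, 0 < T ∧ T < 1 ∧ K * T ≤ 1 / 2 := by
    refine ⟨1 / (2 * (K + 1)), by positivity, ?_, ?_⟩
    · rw [div_lt_one (by positivity)]
      linarith [K.2]
    · rw [mul_one_div, div_le_div_iff₀ (by positivity) two_pos]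
      linarith
  have hsub : Icc 0 T ⊆ Icc (0 : ℝ) 1 := Icc_subset_Icc_right hT1.le
  obtain ⟨A, hA, hAc⟩ := exists_partial_fderiv_pfField (σmax := σmax) hκ hmarg.pos
    D.integrable_marginal
  obtain ⟨γ, M, hγ0, hγ, hM⟩ := exists_hasDerivWithinAt_solver_comp (K := K)
    (fun s hs => (hK₁ s (hsub hs)).weaken (le_max_left _ _))
    (fun s hs => (hK₂ s (hsub hs)).weaken (le_max_right _ _))
    (fun x => (hcond.continuousOn_pfField x).mono hsub)
    (fun x => (hmarg.continuousOn_pfField x).mono hsub) hT0.le hshort hA hAc x₀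
  set S : ℝ → Space d := fun t =>
    score (noised κ (D.cond c) t) (γ t) - score (noised κ D.marginal t) (γ t) with hS
  set f' : ℝ → Space d := fun t => M t (-((σmax * t) • S t)) with hf'
  have hS0 : S 0 = G := by
    rw [hS, hG, gradient_log_posterior D hc hcond.pos (hcond.differentiable x₀) hmarg.pos
      (hmarg.differentiable x₀)]
    simp only [noised_zero, hγ0]
  have hnhds : 𝓝[Icc 0 T] (0 : ℝ) = 𝓝[≥] 0 := nhdsWithin_Icc_eq_nhdsGE hT0
  have hSlim : Tendsto S (𝓝[≥] 0) (𝓝 G) := by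
    have hcont : ContinuousOn S (Icc 0 T) := by
      have hcurve : ContinuousOn (fun t => (t, γ t)) (Icc 0 T) := continuousOn_id.prodMk hγ
      have hmaps : MapsTo (fun t => (t, γ t)) (Icc 0 T) (Icc (0 : ℝ) 1 ×ˢ univ) :=
        fun t ht => ⟨hsub ht, mem_univ _⟩
      exact (hcond.continuous_score.comp hcurve hmaps).sub
        (hmarg.continuous_score.comp hcurve hmaps)
    have h := hcont 0 ⟨le_rfl, hT0.le⟩
    rwa [ContinuousWithinAt, hS0, hnhds] at h
  have hderiv : ∀ᶠ t in 𝓝[≥] (0 : ℝ), HasDerivWithinAt f (f' t) (Icc 0 1) t := by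
    -- The endpoint T is excluded so that, near t, [0, 1] and [0, T] coincide and the derivative
    -- within [0, T] is one within [0, 1].
    filter_upwards [Ico_mem_nhdsGE hT0] with t ht
    have h := (hM t ⟨ht.1, ht.2.le⟩).2
    have hfeq : f = fun t => solver (pfField σmax κ D.marginal) t 0
        (solver (pfField σmax κ (D.cond c)) 0 t x₀) := hf
    have hfield : pfField σmax κ (D.cond c) t (γ t) - pfField σmax κ D.marginal t (γ t) =
        -((σmax * t) • S t) := by
      simp only [pfField, hS, smul_sub]
      abel
    rw [hfield, ← hfeq] at h
    refine h.mono_of_mem_nhdsWithin ?_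
    filter_upwards [self_mem_nhdsWithin, mem_nhdsWithin_of_mem_nhds (Iio_mem_nhds ht.2)] with s hs hsT
    exact ⟨hs.1, le_of_lt hsT⟩
  have hf'0 : f' 0 = 0 := by simp [hf']
  have hlittle : (fun t => f' t - t • -(σmax • G)) =o[𝓝[≥] (0 : ℝ)] fun t => t := by
    refine isLittleO_clm_apply_smul ?_ hSlim σmax
    rw [tendsto_iff_norm_sub_tendsto_zero]
    have hbound : Tendsto (fun t : ℝ => 2 * (K : ℝ) * t) (𝓝[≥] 0) (𝓝 0) := by
      have h : Continuous fun t : ℝ => 2 * (K : ℝ) * t := by fun_prop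
      simpa using (h.tendsto 0).mono_left nhdsWithin_le_nhds
    refine squeeze_zero' (Eventually.of_forall fun t => norm_nonneg _) ?_ hbound
    filter_upwards [Icc_mem_nhdsGE hT0] with t ht using (hM t ht).1
  have hf0 : f 0 = x₀ := by rw [hf, hybridFlow, solver_self, solver_self]
  refine ⟨hf0, ?_, hderiv.mono fun t ht => ht.differentiableWithinAt,
    hasDerivWithinAt_derivWithin_zero hderiv hf'0 hlittle, ?_⟩
  · have h := hderiv.self_of_nhdsWithin self_mem_Ici
    rwa [hf'0] at h
  · refine (mixedSignal_isLittleO hderiv hlittle).congr_left fun t => ?_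
    rw [hf0, smul_neg, sub_neg_eq_add, smul_smul, show t / 2 * σmax = σmax * t / 2 by ring]
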